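/- All graphs are finite, simple, undirected and connected. A graph is a cactus if every edge of it lies on at most one cycle. The augmented Zagreb index of a graph $G$ is $$AZI(G)=\sum_{uv\in E(G)}\left(\frac{d_u d_v}{d_u+d_v-2}\right)^3,$$ where $d_u$ denotes the degree of the vertex $u$. For integers $n\ge 4$ and $k\ge 0$ with $n\ge 2k+1$, let $G^0(n,k)$ be the graph obtained from the star $S_n$ on $n$ vertices by adding $k$ pairwise independent (that is, pairwise disjoint) edges between its pendent vertices (vertices of degree $1$). Let $G$ be a cactus with $n\ge 4$ vertices and exactly $k$ cycles (so that $n\ge 2k+1$). Then $$AZI(G)\ \ge\ (n-2k-1)\left(\frac{n-1}{n-2}\right)^3+24k,$$ with equality if and only if $G$ is isomorphic to $G^0(n,k)$. -/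

import Mathlib

namespace SimpleGraph

/-- The cycles of `G`, as subgraphs: those traced out by a closed walk that is a cycle.
Walks that differ only in starting point or direction give the same cycle. -/
def cycles {V : Type*} (G : SimpleGraph V) : Set G.Subgraph :=
  {C | ∃ (v : V) (p : G.Walk v v), p.IsCycle ∧ p.toSubgraph = C}

/-- A cactus: a connected graph in which every edge lies on at most one cycle. -/
structure IsCactus {V : Type*} (G : SimpleGraph V) : Prop where
  connected : G.Connected
  edge_mem_at_most_one : ∀ e ∈ G.edgeSet, ∀ C ∈ G.cycles, ∀ C' ∈ G.cycles,
    e ∈ C.edgeSet → e ∈ C'.edgeSet → C = C'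

/-- The augmented Zagreb index, the sum over the edges `uv` of
`(d u * d v / (d u + d v - 2)) ^ 3`, where `d` is the degree. -/
noncomputable def augmentedZagreb {V : Type*} [Fintype V] [DecidableEq V]
    (G : SimpleGraph V) [DecidableRel G.Adj] : ℝ :=
  ∑ e ∈ G.edgeFinset,
    Sym2.lift ⟨fun u v : V =>
      ((G.degree u : ℝ) * (G.degree v : ℝ) / ((G.degree u : ℝ) + (G.degree v : ℝ) - 2)) ^ 3,
      fun u v => by
        dsimp only
        rw [mul_comm (G.degree u : ℝ), add_comm (G.degree u : ℝ)]⟩ e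

/-- The graph obtained from the star on `n` vertices, with centre `0`, by adding the `k`
independent edges `{1, 2}, {3, 4}, …, {2k - 1, 2k}` between its pendent vertices.
It is meant for `2 * k + 1 ≤ n`; a cactus with `n` vertices and `k` cycles always satisfies this. -/
def starWithEdges (n k : ℕ) : SimpleGraph (Fin n) :=
  SimpleGraph.fromRel fun i j : Fin n =>
    (i : ℕ) = 0 ∨ ∃ t : ℕ, t < k ∧ (i : ℕ) = 2 * t + 1 ∧ (j : ℕ) = 2 * t + 2

end SimpleGraph

/-!
Let `n` be the number of vertices, `m` of edges, `k` of cycles and `p` of pendant edges of a cactus.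
A pendant edge has weight at least `A = ((n - 1) / (n - 2)) ^ 3`, any other edge at least `8 > A`.
The cycles are edge-disjoint and avoid the pendant edges, so `p + 3 * k ≤ m`; each of them has an
edge of its own outside a spanning tree, so `n + k ≤ m + 1`. Hence the index is at least
`p * A + (m - p) * 8`, which is
`(n - 2 * k - 1) * A + 24 * k + (8 - A) * (m - p - 3 * k) + A * (m + 1 - n - k)`.

Equality forces a vertex adjacent to all others. If there is a pendant edge, its weight is `A` only
if its other end is such a vertex. Otherwise all edges lie on triangles and have an end of degree
two, so all neighbours of a vertex of maximal degree have degree two and no edge leaves its closed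
neighbourhood. Conversely, in a cactus with such a vertex `c` every edge avoiding `c` spans its own
triangle with `c`, so these edges form a matching and the cactus is a star with that matching added.
-/

namespace Cactus

open SimpleGraph

section Cycles

variable {V : Type*} {G : SimpleGraph V} {C : G.Subgraph}

lemma exists_mem_cycles_edgeSet_eq {a b c : V} (hab : G.Adj a b) (hbc : G.Adj b c)
    (hca : G.Adj c a) : ∃ C ∈ G.cycles, C.edgeSet = {s(a, b), s(b, c), s(c, a)} := by
  refine ⟨_, ⟨a, .cons hab (.cons hbc (.cons hca .nil)), ?_, rfl⟩, ?_⟩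
  · rw [Walk.cons_isCycle_iff]
    simp [Walk.cons_isPath_iff, hab.ne, hab.ne', hbc.ne, hca.ne, hca.ne']
  · ext e
    simp only [Walk.mem_edges_toSubgraph, Walk.edges_cons, Walk.edges_nil, List.mem_cons,
      List.not_mem_nil, or_false, Set.mem_insert_iff, Set.mem_singleton_iff]

lemma ncard_edgeSet_toSubgraph {u v : V} {p : G.Walk u v} (hp : p.IsTrail) :
    p.toSubgraph.edgeSet.ncard = p.length := by
  classical
  have hedges : p.toSubgraph.edgeSet = (p.edges.toFinset : Set (Sym2 V)) := by ext e; simp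
  rw [hedges, Set.ncard_coe_finset, List.toFinset_card_of_nodup hp.edges_nodup, Walk.length_edges]

lemma three_le_ncard_edgeSet (hC : C ∈ G.cycles) : 3 ≤ C.edgeSet.ncard := by
  obtain ⟨v, p, hp, rfl⟩ := hC
  exact (ncard_edgeSet_toSubgraph hp.isTrail).symm ▸ hp.three_le_length

lemma exists_adj_adj_of_ncard_edgeSet_eq_three (hC : C ∈ G.cycles) (h3 : C.edgeSet.ncard = 3)
    {x y : V} (hxy : s(x, y) ∈ C.edgeSet) : ∃ z, G.Adj x z ∧ G.Adj y z := by
  obtain ⟨v, p, hp, rfl⟩ := hC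
  rw [ncard_edgeSet_toSubgraph hp.isTrail] at h3
  rw [Walk.mem_edges_toSubgraph] at hxy
  match p, h3 with
  | .cons (v := b) hab (.cons (v := c) hbc (.cons hca .nil)), _ =>
    have := hab.symm
    have := hbc.symm
    have := hca.symm
    simp only [Walk.edges_cons, Walk.edges_nil, List.mem_cons, List.not_mem_nil, or_false,
      Sym2.eq_iff] at hxy
    grind

lemma degree_ne_one_of_mem_cycles (hC : C ∈ G.cycles) {e : Sym2 V} (he : e ∈ C.edgeSet) {v : V}
    (hv : v ∈ e) [Fintype (G.neighborSet v)] : G.degree v ≠ 1 := by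
  obtain ⟨u, p, hp, rfl⟩ := hC
  obtain ⟨w, rfl⟩ := hv
  rw [Walk.mem_edges_toSubgraph] at he
  have htwo := hp.ncard_neighborSet_toSubgraph_eq_two (p.fst_mem_support_of_mem_edges he)
  have hle := Set.ncard_le_ncard (p.toSubgraph.neighborSet_subset v) (Set.toFinite _)
  rw [htwo, Set.ncard_eq_toFinset_card', ← neighborFinset_def, card_neighborFinset_eq_degree]
    at hle
  omega

lemma exists_mem_edgeSet_notMem_of_isAcyclic {T : SimpleGraph V} (hT : T.IsAcyclic)
    (hC : C ∈ G.cycles) : ∃ e ∈ C.edgeSet, e ∉ T.edgeSet := by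
  obtain ⟨u, p, hp, rfl⟩ := hC
  by_contra! h
  exact hT _ (hp.transfer fun e he => h e (p.mem_edges_toSubgraph.2 he))

end Cycles

section Degrees

variable {V : Type*} {G : SimpleGraph V}

lemma eq_of_adj_of_degree_eq_one {v a b : V} [Fintype (G.neighborSet v)] (h : G.degree v = 1)
    (ha : G.Adj v a) (hb : G.Adj v b) : a = b :=
  (degree_eq_one_iff_existsUnique_adj.1 h).unique ha hb

lemma eq_or_eq_of_adj_of_degree_eq_two {v a b w : V} [Fintype (G.neighborSet v)]
    (h : G.degree v = 2) (hab : a ≠ b) (ha : G.Adj v a) (hb : G.Adj v b) (hw : G.Adj v w) :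
    w = a ∨ w = b := by
  classical
  have hsub : {a, b} ⊆ G.neighborFinset v := by simp [Finset.insert_subset_iff, ha, hb]
  have heq := Finset.eq_of_subset_of_card_le hsub
    (by rw [card_neighborFinset_eq_degree, h, Finset.card_pair hab])
  simpa [← heq] using (G.mem_neighborFinset v w).2 hw

lemma isUniversal_of_forall_adj_adj (hG : G.Connected) {c : V}
    (h : ∀ v w, G.Adj c v → G.Adj v w → w = c ∨ G.Adj c w) : G.IsUniversal c := by
  have hclosed : ∀ w, G.Reachable c w → w = c ∨ G.Adj c w := by
    intro w hw
    rw [reachable_iff_reflTransGen] at hw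
    induction hw with
    | refl => exact .inl rfl
    | tail _ hvw ih =>
      rcases ih with rfl | hcv
      · exact .inr hvw
      · exact h _ _ hcv hvw
  exact fun w hw => (hclosed w (hG.preconnected c w)).resolve_left hw.symm

variable [Fintype V] [DecidableRel G.Adj]

lemma two_le_degree_of_adj_of_degree_eq_one (hG : G.Connected) (hV : 3 ≤ Fintype.card V) {u v : V}
    (huv : G.Adj u v) (hu : G.degree u = 1) : 2 ≤ G.degree v := by
  have hpos : 0 < G.degree v := (G.degree_pos_iff_exists_adj v).2 ⟨u, huv.symm⟩
  by_contra hlt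
  have huniv : G.IsUniversal u := isUniversal_of_forall_adj_adj hG fun a b ha hb => by
    rw [← eq_of_adj_of_degree_eq_one hu huv ha] at hb
    exact .inl (eq_of_adj_of_degree_eq_one (by omega) hb huv.symm)
  have := (G.degree_eq_card_sub_one u).2 huniv
  omega

lemma exists_isUniversal_of_forall_adj_degree_eq_two (hG : G.Connected)
    (htriangle : ∀ u v, G.Adj u v → ∃ z, G.Adj u z ∧ G.Adj v z)
    (hdegree : ∀ u v, G.Adj u v → G.degree u = 2 ∨ G.degree v = 2) : ∃ c, G.IsUniversal c := by
  have := hG.nonempty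
  obtain ⟨c, hc⟩ := G.exists_maximal_degree_vertex
  have hmax : ∀ v, G.degree v ≤ G.degree c := fun v => hc ▸ G.degree_le_maxDegree v
  have htwo : ∀ v, G.Adj c v → G.degree v = 2 := by
    intro v hcv
    obtain ⟨z, hcz, hvz⟩ := htriangle c v hcv
    have hlt : 1 < G.degree v := by
      rw [← card_neighborFinset_eq_degree, Finset.one_lt_card]
      exact ⟨c, by simpa using hcv.symm, z, by simpa using hvz, hcz.ne⟩
    have := hmax v
    have := hdegree c v hcv
    omega
  refine ⟨c, isUniversal_of_forall_adj_adj hG fun v w hcv hvw => ?_⟩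
  obtain ⟨z, hcz, hvz⟩ := htriangle c v hcv
  rcases eq_or_eq_of_adj_of_degree_eq_two (htwo v hcv) hcz.ne hcv.symm hvz hvw with rfl | rfl
  · exact .inl rfl
  · exact .inr hcz

end Degrees

section Counting

variable {V : Type*} [Fintype V] {G : SimpleGraph V} [DecidableRel G.Adj]

lemma card_add_ncard_cycles_le (hG : G.IsCactus) :
    Fintype.card V + G.cycles.ncard ≤ G.edgeFinset.card + 1 := by
  classical
  obtain ⟨T, hTG, hT⟩ := hG.connected.exists_isTree_le
  have : Nonempty (Sym2 V) := hG.connected.nonempty.map fun v => s(v, v)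
  choose! f hf hfT using fun (C : G.Subgraph) (hC : C ∈ G.cycles) =>
    exists_mem_edgeSet_notMem_of_isAcyclic hT.isAcyclic hC
  have hcycles : G.cycles.ncard ≤ (G.edgeFinset \ T.edgeFinset).card := by
    rw [← Set.ncard_coe_finset]
    refine Set.ncard_le_ncard_of_injOn f (fun C hC => ?_) fun C hC C' hC' h => ?_
    · simpa using ⟨C.edgeSet_subset (hf C hC), hfT C hC⟩
    · exact hG.edge_mem_at_most_one (f C) (C.edgeSet_subset (hf C hC)) C hC C' hC' (hf C hC)
        (h ▸ hf C' hC')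
  rw [Finset.card_sdiff_of_subset (edgeFinset_mono hTG)] at hcycles
  have := Finset.card_le_card (edgeFinset_mono hTG)
  have := hT.card_edgeFinset
  omega

open Classical in
/-- The edges of `G` that lie on at least one cycle. -/
noncomputable def cycleEdges (G : SimpleGraph V) [DecidableRel G.Adj] : Finset (Sym2 V) :=
  {e ∈ G.edgeFinset | ∃ C ∈ G.cycles, e ∈ C.edgeSet}

lemma mem_cycleEdges {e : Sym2 V} : e ∈ cycleEdges G ↔ ∃ C ∈ G.cycles, e ∈ C.edgeSet := by
  simp only [cycleEdges, Finset.mem_filter, mem_edgeFinset, and_iff_right_iff_imp]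
  rintro ⟨C, -, he⟩
  exact C.edgeSet_subset he

lemma cycleEdges_subset_edgeFinset : cycleEdges G ⊆ G.edgeFinset := by
  classical exact Finset.filter_subset _ _

lemma card_cycleEdges (hG : G.IsCactus) :
    (cycleEdges G).card = ∑ C ∈ G.cycles.toFinite.toFinset, C.edgeSet.ncard := by
  classical
  have hunion : cycleEdges G =
      G.cycles.toFinite.toFinset.biUnion fun C => C.edgeSet.toFinset := by
    ext e
    simp only [mem_cycleEdges, Finset.mem_biUnion, Set.Finite.mem_toFinset, Set.mem_toFinset]
  rw [hunion, Finset.card_biUnion]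
  · simp only [Set.ncard_eq_toFinset_card']
  · intro C hC C' hC' hne
    rw [Finset.mem_coe, Set.Finite.mem_toFinset] at hC hC'
    rw [Function.onFun, Set.disjoint_toFinset, Set.disjoint_left]
    exact fun e he he' => hne
      (hG.edge_mem_at_most_one e (C.edgeSet_subset he) C hC C' hC' he he')

lemma three_mul_ncard_cycles_le (hG : G.IsCactus) : 3 * G.cycles.ncard ≤ (cycleEdges G).card := by
  rw [card_cycleEdges hG, Set.ncard_eq_toFinset_card G.cycles, mul_comm, ← smul_eq_mul]
  exact Finset.card_nsmul_le_sum _ _ _ fun C hC =>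
    three_le_ncard_edgeSet ((Set.Finite.mem_toFinset _).1 hC)

lemma ncard_edgeSet_eq_three (hG : G.IsCactus)
    (h : (cycleEdges G).card = 3 * G.cycles.ncard) {C : G.Subgraph} (hC : C ∈ G.cycles) :
    C.edgeSet.ncard = 3 := by
  have hge : ∀ C ∈ G.cycles.toFinite.toFinset, 3 ≤ C.edgeSet.ncard := fun C hC =>
    three_le_ncard_edgeSet ((Set.Finite.mem_toFinset _).1 hC)
  refine ((Finset.sum_eq_sum_iff_of_le hge).1 ?_ C ((Set.Finite.mem_toFinset _).2 hC)).symm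
  rw [← card_cycleEdges hG, h, Finset.sum_const, smul_eq_mul, mul_comm,
    Set.ncard_eq_toFinset_card G.cycles]

variable [DecidableEq V]

/-- The pendant edges of `G`: those with an endpoint of degree one. -/
def pendantEdges (G : SimpleGraph V) [DecidableRel G.Adj] : Finset (Sym2 V) :=
  {e ∈ G.edgeFinset | ∃ v ∈ e, G.degree v = 1}

lemma mem_pendantEdges {e : Sym2 V} :
    e ∈ pendantEdges G ↔ e ∈ G.edgeSet ∧ ∃ v ∈ e, G.degree v = 1 := by
  simp [pendantEdges]

lemma pendantEdges_subset_edgeFinset : pendantEdges G ⊆ G.edgeFinset :=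
  Finset.filter_subset _ _

lemma disjoint_pendantEdges_cycleEdges : Disjoint (pendantEdges G) (cycleEdges G) := by
  refine Finset.disjoint_left.2 fun e hpendant hcycle => ?_
  obtain ⟨-, v, hv, hdeg⟩ := mem_pendantEdges.1 hpendant
  obtain ⟨C, hC, heC⟩ := mem_cycleEdges.1 hcycle
  exact degree_ne_one_of_mem_cycles hC heC hv hdeg

lemma pendantEdges_union_cycleEdges_subset : pendantEdges G ∪ cycleEdges G ⊆ G.edgeFinset :=
  Finset.union_subset pendantEdges_subset_edgeFinset cycleEdges_subset_edgeFinset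

lemma card_pendantEdges_add_three_mul_ncard_cycles_le (hG : G.IsCactus) :
    (pendantEdges G).card + 3 * G.cycles.ncard ≤ G.edgeFinset.card := by
  have := three_mul_ncard_cycles_le hG
  have := Finset.card_le_card (pendantEdges_union_cycleEdges_subset (G := G))
  rw [Finset.card_union_of_disjoint disjoint_pendantEdges_cycleEdges] at this
  omega

lemma exists_adj_adj_of_notMem_pendantEdges (hG : G.IsCactus)
    (h : (pendantEdges G).card + 3 * G.cycles.ncard = G.edgeFinset.card) {u v : V}
    (huv : G.Adj u v) (hp : s(u, v) ∉ pendantEdges G) : ∃ z, G.Adj u z ∧ G.Adj v z := by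
  have hcycle := three_mul_ncard_cycles_le hG
  have hcard := Finset.card_union_of_disjoint (disjoint_pendantEdges_cycleEdges (G := G))
  have hle := Finset.card_le_card (pendantEdges_union_cycleEdges_subset (G := G))
  have hcover := Finset.eq_of_subset_of_card_le (pendantEdges_union_cycleEdges_subset (G := G))
    (by omega)
  have hmem : s(u, v) ∈ pendantEdges G ∪ cycleEdges G := hcover ▸ mem_edgeFinset.2 huv
  obtain ⟨C, hC, huvC⟩ := mem_cycleEdges.1 ((Finset.mem_union.1 hmem).resolve_left hp)
  exact exists_adj_adj_of_ncard_edgeSet_eq_three hC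
    (ncard_edgeSet_eq_three hG (by omega) hC) huvC

end Counting

section Universal

variable {V : Type*} {G : SimpleGraph V} {c : V}

lemma eq_of_adj_of_isUniversal (hG : G.IsCactus) (hc : G.IsUniversal c) {v a b : V} (hv : v ≠ c)
    (ha : a ≠ c) (hb : b ≠ c) (hva : G.Adj v a) (hvb : G.Adj v b) : a = b := by
  -- Otherwise the edge `cv` would lie on the two triangles `cva` and `cvb`.
  obtain ⟨C, hC, hCe⟩ := exists_mem_cycles_edgeSet_eq (hc hv.symm) hva (hc ha.symm).symm
  obtain ⟨D, hD, hDe⟩ := exists_mem_cycles_edgeSet_eq (hc hv.symm) hvb (hc hb.symm).symm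
  have hCD : C = D := hG.edge_mem_at_most_one s(c, v) (hc hv.symm) C hC D hD (by simp [hCe])
    (by simp [hDe])
  have hmem : s(v, a) ∈ D.edgeSet := by simp [← hCD, hCe]
  simp only [hDe, Set.mem_insert_iff, Set.mem_singleton_iff, Sym2.eq_iff] at hmem
  have := hva.ne
  grind

lemma degree_le_two_of_isUniversal (hG : G.IsCactus) (hc : G.IsUniversal c) {v : V} (hv : v ≠ c)
    [Fintype (G.neighborSet v)] : G.degree v ≤ 2 := by
  classical
  have hone : ((G.neighborFinset v).erase c).card ≤ 1 := by
    refine Finset.card_le_one.2 fun a ha b hb => ?_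
    rw [Finset.mem_erase, mem_neighborFinset] at ha hb
    exact eq_of_adj_of_isUniversal hG hc hv ha.1 hb.1 ha.2 hb.2
  have := Finset.pred_card_le_card_erase (s := G.neighborFinset v) (a := c)
  rw [← card_neighborFinset_eq_degree]
  omega

lemma exists_mem_cycles_of_isUniversal (hc : G.IsUniversal c) {e : Sym2 V} (he : e ∈ G.edgeSet)
    (hce : c ∉ e) : ∃ C ∈ G.cycles, e ∈ C.edgeSet ∧ ∀ f ∈ C.edgeSet, c ∉ f → f = e := by
  induction e with
  | h a b =>
    rw [Sym2.mem_iff, not_or] at hce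
    obtain ⟨C, hC, hCe⟩ := exists_mem_cycles_edgeSet_eq he (hc hce.2).symm (hc hce.1)
    refine ⟨C, hC, by simp [hCe], fun f hf hcf => ?_⟩
    rw [hCe] at hf
    rcases hf with rfl | rfl | rfl
    · rfl
    · simp at hcf
    · simp at hcf

variable [Fintype V] [DecidableEq V] [DecidableRel G.Adj]

/-- The edges of `G` that do not contain the vertex `c`. -/
def edgesAvoiding (G : SimpleGraph V) [DecidableRel G.Adj] (c : V) : Finset (Sym2 V) :=
  {e ∈ G.edgeFinset | c ∉ e}

lemma mem_edgesAvoiding {e : Sym2 V} : e ∈ edgesAvoiding G c ↔ e ∈ G.edgeSet ∧ c ∉ e := by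
  simp [edgesAvoiding]

variable (G c) in
lemma card_edgesAvoiding_add_degree :
    (edgesAvoiding G c).card + G.degree c = G.edgeFinset.card := by
  rw [← card_incidenceFinset_eq_degree, incidenceFinset_eq_filter, edgesAvoiding, add_comm,
    Finset.card_filter_add_card_filter_not]

lemma card_edgesAvoiding_le_ncard_cycles (hc : G.IsUniversal c) :
    (edgesAvoiding G c).card ≤ G.cycles.ncard := by
  choose! f hf hef hfe using fun (e : Sym2 V) (h : e ∈ G.edgeSet ∧ c ∉ e) =>
    exists_mem_cycles_of_isUniversal hc h.1 h.2
  rw [← Set.ncard_coe_finset]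
  refine Set.ncard_le_ncard_of_injOn f (fun e he => hf e (mem_edgesAvoiding.1 he))
    fun e he e' he' h => ?_
  have he := mem_edgesAvoiding.1 he
  exact hfe e' (mem_edgesAvoiding.1 he') e (h ▸ hef e he) he.2

omit [DecidableEq V] in
lemma card_edgeFinset_add_one_of_isUniversal (hG : G.IsCactus) (hc : G.IsUniversal c) :
    G.edgeFinset.card + 1 = Fintype.card V + G.cycles.ncard := by
  classical
  have := card_edgesAvoiding_le_ncard_cycles hc
  have := card_add_ncard_cycles_le hG
  have := card_edgesAvoiding_add_degree G c
  have := (G.degree_eq_card_sub_one c).2 hc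
  have : 0 < Fintype.card V := Fintype.card_pos_iff.2 ⟨c⟩
  omega

lemma card_edgesAvoiding (hG : G.IsCactus) (hc : G.IsUniversal c) :
    (edgesAvoiding G c).card = G.cycles.ncard := by
  have := card_edgeFinset_add_one_of_isUniversal hG hc
  have := card_edgesAvoiding_add_degree G c
  have := (G.degree_eq_card_sub_one c).2 hc
  have : 0 < Fintype.card V := Fintype.card_pos_iff.2 ⟨c⟩
  omega

lemma degree_eq_one_of_forall_notMem (hc : G.IsUniversal c) {v : V} (hv : v ≠ c)
    (h : ∀ e ∈ edgesAvoiding G c, v ∉ e) : G.degree v = 1 := by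
  refine degree_eq_one_iff_existsUnique_adj.2 ⟨c, (hc hv.symm).symm, fun w hvw => ?_⟩
  by_contra hwc
  exact h s(v, w) (mem_edgesAvoiding.2 ⟨hvw, by simp [hv.symm, Ne.symm hwc]⟩)
    (Sym2.mem_mk_left v w)

lemma card_le_card_pendantEdges_add (hc : G.IsUniversal c) :
    Fintype.card V ≤ (pendantEdges G).card + 2 * (edgesAvoiding G c).card + 1 := by
  set U := (edgesAvoiding G c).biUnion Sym2.toFinset
  have hU : U.card ≤ (edgesAvoiding G c).card * 2 :=
    Finset.card_biUnion_le_card_mul _ _ _ fun e _ => by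
      rw [Sym2.card_toFinset]; split_ifs <;> omega
  have hspokes : ((Finset.univ.erase c) \ U).card ≤ (pendantEdges G).card := by
    refine Finset.card_le_card_of_injOn (fun v => s(c, v)) (fun v hv => ?_)
      fun v _ w _ h => Sym2.congr_right.1 h
    rw [Finset.mem_coe, Finset.mem_sdiff, Finset.mem_erase] at hv
    refine mem_pendantEdges.2 ⟨hc hv.1.1.symm, v, Sym2.mem_mk_right c v,
      degree_eq_one_of_forall_notMem hc hv.1.1 fun e he hve => hv.2 ?_⟩
    exact Finset.mem_biUnion.2 ⟨e, he, Sym2.mem_toFinset.2 hve⟩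
  have := Finset.le_card_sdiff U (Finset.univ.erase c)
  rw [Finset.card_erase_of_mem (Finset.mem_univ c), Finset.card_univ] at this
  omega

lemma card_pendantEdges_add_three_mul_ncard_cycles_of_isUniversal (hG : G.IsCactus)
    (hc : G.IsUniversal c) :
    (pendantEdges G).card + 3 * G.cycles.ncard = G.edgeFinset.card := by
  have := card_pendantEdges_add_three_mul_ncard_cycles_le hG
  have := card_edgeFinset_add_one_of_isUniversal hG hc
  have := card_le_card_pendantEdges_add hc
  have := card_edgesAvoiding hG hc
  omega

end Universal

section MatchingCone

variable {V W ι : Type*} {G : SimpleGraph V} {H : SimpleGraph W} {c : V} {d : W}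
  {x : ι × Fin 2 → V} {y : ι × Fin 2 → W}

/-- `G` is a star with centre `c` to which the pairwise disjoint edges joining `x (t, 0)` to
`x (t, 1)` have been added, one for each `t : ι`. Isomorphisms with `starWithEdges` are built by
matching up these data. -/
structure IsMatchingCone (G : SimpleGraph V) (c : V) (x : ι × Fin 2 → V) : Prop where
  injective : Function.Injective x
  ne_center : ∀ z, x z ≠ c
  adj_iff : ∀ a b, G.Adj a b ↔
    a ≠ b ∧ (a = c ∨ b = c ∨ ∃ t, s(a, b) = s(x (t, 0), x (t, 1)))

lemma exists_equiv_forall_apply_eq {α : Type*} [Finite α] (e : V ≃ W) {f : α → V} {g : α → W}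
    (hf : Function.Injective f) (hg : Function.Injective g) :
    ∃ σ : V ≃ W, ∀ a, σ (f a) = g a := by
  obtain ⟨σ, hσ⟩ := Equiv.Perm.exists_extending_pair (e ∘ f) g (e.injective.comp hf) hg
  exact ⟨e.trans σ, hσ⟩

lemma IsMatchingCone.nonempty_iso [Finite ι] (hG : IsMatchingCone G c x)
    (hH : IsMatchingCone H d y) (e : V ≃ W) : Nonempty (G ≃g H) := by
  obtain ⟨σ, hσ⟩ := exists_equiv_forall_apply_eq e
    (Option.injective_iff (f := fun o => o.elim c x).2
      ⟨hG.injective, fun ⟨z, hz⟩ => hG.ne_center z hz⟩)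
    (Option.injective_iff (f := fun o => o.elim d y).2
      ⟨hH.injective, fun ⟨z, hz⟩ => hH.ne_center z hz⟩)
  have hcenter : σ c = d := hσ none
  have hmatching : ∀ z, σ (x z) = y z := fun z => hσ (some z)
  refine ⟨⟨σ, fun {a b} => ?_⟩⟩
  simp only [hG.adj_iff, hH.adj_iff, ← hcenter, ← hmatching, σ.injective.eq_iff, ne_eq,
    Sym2.eq_iff]

lemma isMatchingCone_starWithEdges {n k : ℕ} (h : 2 * k + 1 ≤ n) :
    IsMatchingCone (starWithEdges n k) ⟨0, by omega⟩
      fun z : Fin k × Fin 2 => ⟨2 * z.1 + z.2 + 1, by omega⟩ where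
  injective := by
    rintro ⟨s, i⟩ ⟨t, j⟩ hst
    simp only [Prod.mk.injEq, Fin.ext_iff] at hst ⊢
    omega
  ne_center z hz := by simp at hz
  adj_iff a b := by
    simp only [starWithEdges, fromRel_adj, Sym2.eq_iff, Fin.ext_iff, ne_eq]
    constructor
    · rintro ⟨hab, (h | ⟨t, ht, ha, hb⟩) | h | ⟨t, ht, hb, ha⟩⟩
      · exact ⟨hab, .inl h⟩
      · exact ⟨hab, .inr (.inr ⟨⟨t, ht⟩, .inl ⟨ha, hb⟩⟩)⟩
      · exact ⟨hab, .inr (.inl h)⟩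
      · exact ⟨hab, .inr (.inr ⟨⟨t, ht⟩, .inr ⟨ha, hb⟩⟩)⟩
    · rintro ⟨hab, h | h | ⟨t, ⟨ha, hb⟩ | ⟨ha, hb⟩⟩⟩
      · exact ⟨hab, .inl (.inl h)⟩
      · exact ⟨hab, .inr (.inl h)⟩
      · exact ⟨hab, .inl (.inr ⟨t, t.2, ha, hb⟩)⟩
      · exact ⟨hab, .inr (.inr ⟨t, t.2, hb, ha⟩)⟩

lemma isUniversal_zero_starWithEdges {n k : ℕ} [NeZero n] : (starWithEdges n k).IsUniversal 0 :=
  fun _ hb => (fromRel_adj _ _ _).2 ⟨hb, .inl (.inl rfl)⟩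

lemma isUniversal_symm_apply (f : G ≃g H) (hd : H.IsUniversal d) : G.IsUniversal (f.symm d) := by
  intro w hw
  rw [← f.map_adj_iff, f.apply_symm_apply]
  exact hd fun h => hw (f.symm_apply_eq.2 h)

section CactusWithUniversal

variable [Fintype V] [DecidableEq V] [DecidableRel G.Adj]

lemma eq_of_mem_edgesAvoiding (hG : G.IsCactus) (hc : G.IsUniversal c) {e f : Sym2 V}
    (he : e ∈ edgesAvoiding G c) (hf : f ∈ edgesAvoiding G c) {v : V} (hve : v ∈ e)
    (hvf : v ∈ f) : e = f := by
  obtain ⟨a, rfl⟩ := hve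
  obtain ⟨b, rfl⟩ := hvf
  simp only [mem_edgesAvoiding, mem_edgeSet, Sym2.mem_iff, not_or] at he hf
  rw [eq_of_adj_of_isUniversal hG hc (Ne.symm he.2.1) (Ne.symm he.2.2) (Ne.symm hf.2.2) he.1 hf.1]

lemma exists_isMatchingCone (hG : G.IsCactus) (hc : G.IsUniversal c)
    (q : ι ≃ edgesAvoiding G c) : ∃ x : ι × Fin 2 → V, IsMatchingCone G c x := by
  let x : ι × Fin 2 → V := fun z => ![(q z.1).1.out.1, (q z.1).1.out.2] z.2
  have hx : ∀ t, s(x (t, 0), x (t, 1)) = q t := fun t => Quot.out_eq _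
  have hmem : ∀ t i, x (t, i) ∈ (q t : Sym2 V) := fun t i => by
    rw [← hx]; fin_cases i <;> simp
  have hedge : ∀ t, (q t : Sym2 V) ∈ G.edgeSet ∧ c ∉ (q t : Sym2 V) := fun t =>
    mem_edgesAvoiding.1 (q t).2
  have hadj : ∀ t, G.Adj (x (t, 0)) (x (t, 1)) := fun t => by
    rw [← mem_edgeSet, hx]; exact (hedge t).1
  refine ⟨x, ?_, ?_, fun a b => ⟨fun hab => ⟨hab.ne, ?_⟩, ?_⟩⟩
  · rintro ⟨s, i⟩ ⟨t, j⟩ h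
    obtain rfl : s = t := q.injective <| Subtype.ext <|
      eq_of_mem_edgesAvoiding hG hc (q s).2 (q t).2 (hmem s i) (h ▸ hmem t j)
    have := (hadj s).ne
    fin_cases i <;> fin_cases j <;> simp_all
  · intro ⟨t, i⟩ h
    have hct := hmem t i
    rw [h] at hct
    exact (hedge t).2 hct
  · by_cases ha : a = c
    · exact .inl ha
    by_cases hb : b = c
    · exact .inr (.inl hb)
    obtain ⟨t, ht⟩ := q.surjective
      ⟨s(a, b), mem_edgesAvoiding.2 ⟨hab, by simp [Ne.symm ha, Ne.symm hb]⟩⟩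
    exact .inr (.inr ⟨t, by rw [hx, ht]⟩)
  · rintro ⟨hab, rfl | rfl | ⟨t, ht⟩⟩
    · exact hc hab
    · exact (hc hab.symm).symm
    · rw [← mem_edgeSet, ht]
      exact hadj t

end CactusWithUniversal

lemma nonempty_iso_starWithEdges_iff [Fintype V] (hG : G.IsCactus) :
    Nonempty (G ≃g starWithEdges (Fintype.card V) G.cycles.ncard) ↔ ∃ c, G.IsUniversal c := by
  classical
  have := hG.connected.nonempty
  refine ⟨fun ⟨f⟩ => ⟨_, isUniversal_symm_apply f isUniversal_zero_starWithEdges⟩, ?_⟩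
  rintro ⟨c, hc⟩
  obtain ⟨x, hx⟩ := exists_isMatchingCone hG hc
    (Finset.equivFinOfCardEq (card_edgesAvoiding hG hc)).symm
  have hcard : 2 * G.cycles.ncard + 1 ≤ Fintype.card V := by
    have := card_edgeFinset_add_one_of_isUniversal hG hc
    have := card_pendantEdges_add_three_mul_ncard_cycles_of_isUniversal hG hc
    omega
  exact hx.nonempty_iso (isMatchingCone_starWithEdges hcard) (Fintype.equivFin V)

end MatchingCone

section Weight

/-- The contribution to the augmented Zagreb index of an edge whose endpoints have degrees `x`
and `y`. -/
noncomputable def zagrebWeight (x y : ℝ) : ℝ := (x * y / (x + y - 2)) ^ 3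

lemma zagrebWeight_comm (x y : ℝ) : zagrebWeight x y = zagrebWeight y x := by
  rw [zagrebWeight, zagrebWeight, mul_comm, add_comm]

lemma zagrebWeight_one_sub_one (x : ℝ) : zagrebWeight 1 (x - 1) = ((x - 1) / (x - 2)) ^ 3 := by
  rw [zagrebWeight]
  ring_nf

lemma strictAntiOn_zagrebWeight_one : StrictAntiOn (zagrebWeight 1) (Set.Ioi 1) := by
  intro x hx y hy hxy
  rw [Set.mem_Ioi] at hx hy
  have hdiv : 1 * y / (1 + y - 2) < 1 * x / (1 + x - 2) := by
    rw [div_lt_div_iff₀ (by linarith) (by linarith)]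
    linarith
  exact pow_lt_pow_left₀ hdiv (div_nonneg (by linarith) (by linarith)) three_ne_zero

lemma zagrebWeight_one_two : zagrebWeight 1 2 = 8 := by
  norm_num [zagrebWeight]

lemma zagrebWeight_one_pos {x : ℝ} (hx : 1 < x) : 0 < zagrebWeight 1 x :=
  pow_pos (div_pos (by linarith) (by linarith)) 3

lemma zagrebWeight_one_lt_eight {x : ℝ} (hx : 2 < x) : zagrebWeight 1 x < 8 :=
  zagrebWeight_one_two ▸
    strictAntiOn_zagrebWeight_one (Set.mem_Ioi.2 one_lt_two) (one_lt_two.trans hx) hx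

variable {x y : ℝ}

lemma eight_le_zagrebWeight (hx : 2 ≤ x) (hy : 2 ≤ y) : 8 ≤ zagrebWeight x y := by
  have htwo : 2 ≤ x * y / (x + y - 2) := by
    rw [le_div_iff₀ (by linarith)]
    nlinarith [mul_nonneg (sub_nonneg.2 hx) (sub_nonneg.2 hy)]
  calc (8 : ℝ) = 2 ^ 3 := by norm_num
    _ ≤ zagrebWeight x y := pow_le_pow_left₀ zero_le_two htwo 3

lemma zagrebWeight_eq_eight_iff (hx : 2 ≤ x) (hy : 2 ≤ y) :
    zagrebWeight x y = 8 ↔ x = 2 ∨ y = 2 := by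
  have hpos : 0 < x + y - 2 := by linarith
  rw [zagrebWeight, show (8 : ℝ) = 2 ^ 3 by norm_num,
    pow_left_inj₀ (by positivity) zero_le_two three_ne_zero, div_eq_iff hpos.ne',
    ← sub_eq_zero (a := x), ← sub_eq_zero (a := y), ← mul_eq_zero]
  constructor <;> intro h <;> linarith

end Weight

section EdgeWeight

variable {V : Type*} [Fintype V] {G : SimpleGraph V} [DecidableRel G.Adj] {u v : V}

/-- The summand of the edge `e` in the augmented Zagreb index of `G`. -/
noncomputable def edgeWeight (G : SimpleGraph V) [DecidableRel G.Adj] (e : Sym2 V) : ℝ :=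
  Sym2.lift ⟨fun u v : V => zagrebWeight (G.degree u) (G.degree v),
    fun _ _ => zagrebWeight_comm _ _⟩ e

lemma edgeWeight_mk (u v : V) :
    edgeWeight G s(u, v) = zagrebWeight (G.degree u) (G.degree v) := rfl

lemma augmentedZagreb_eq_sum_edgeWeight [DecidableEq V] :
    G.augmentedZagreb = ∑ e ∈ G.edgeFinset, edgeWeight G e := rfl

lemma degree_le_card_sub_one (v : V) : (G.degree v : ℝ) ≤ Fintype.card V - 1 := by
  rw [le_sub_iff_add_le]
  exact_mod_cast G.degree_lt_card_verts v

lemma degree_eq_card_sub_one_iff :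
    (G.degree v : ℝ) = Fintype.card V - 1 ↔ G.IsUniversal v := by
  have : 0 < Fintype.card V := Fintype.card_pos_iff.2 ⟨v⟩
  rw [← G.degree_eq_card_sub_one, ← Nat.cast_pred this, Nat.cast_inj]

lemma zagrebWeight_le_edgeWeight_of_degree_eq_one (hG : G.Connected) (hV : 3 ≤ Fintype.card V)
    (huv : G.Adj u v) (hu : G.degree u = 1) :
    zagrebWeight 1 (Fintype.card V - 1) ≤ edgeWeight G s(u, v) := by
  have hle := degree_le_card_sub_one (G := G) v
  have hv : (1 : ℝ) < G.degree v := by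
    exact_mod_cast two_le_degree_of_adj_of_degree_eq_one hG hV huv hu
  rw [edgeWeight_mk, hu, Nat.cast_one]
  exact strictAntiOn_zagrebWeight_one.antitoneOn hv (hv.trans_le hle) hle

lemma edgeWeight_eq_zagrebWeight_iff_isUniversal (hG : G.Connected) (hV : 3 ≤ Fintype.card V)
    (huv : G.Adj u v) (hu : G.degree u = 1) :
    edgeWeight G s(u, v) = zagrebWeight 1 (Fintype.card V - 1) ↔ G.IsUniversal v := by
  have hle := degree_le_card_sub_one (G := G) v
  have hv : (1 : ℝ) < G.degree v := by
    exact_mod_cast two_le_degree_of_adj_of_degree_eq_one hG hV huv hu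
  rw [edgeWeight_mk, hu, Nat.cast_one,
    strictAntiOn_zagrebWeight_one.injOn.eq_iff hv (hv.trans_le hle), degree_eq_card_sub_one_iff]

lemma eight_le_edgeWeight (hu : 2 ≤ G.degree u) (hv : 2 ≤ G.degree v) :
    8 ≤ edgeWeight G s(u, v) :=
  eight_le_zagrebWeight (by exact_mod_cast hu) (by exact_mod_cast hv)

lemma edgeWeight_eq_eight_iff (hu : 2 ≤ G.degree u) (hv : 2 ≤ G.degree v) :
    edgeWeight G s(u, v) = 8 ↔ G.degree u = 2 ∨ G.degree v = 2 := by
  rw [edgeWeight_mk, zagrebWeight_eq_eight_iff (by exact_mod_cast hu) (by exact_mod_cast hv)]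
  norm_cast

end EdgeWeight

section Bound

variable {V : Type*} [Fintype V] [DecidableEq V] {G : SimpleGraph V} [DecidableRel G.Adj]

lemma exists_eq_mk_of_mem_pendantEdges {e : Sym2 V} (he : e ∈ pendantEdges G) :
    ∃ u v, e = s(u, v) ∧ G.Adj u v ∧ G.degree u = 1 := by
  obtain ⟨huv, u, ⟨v, rfl⟩, hu⟩ := mem_pendantEdges.1 he
  exact ⟨u, v, rfl, huv, hu⟩

lemma two_le_degree_of_notMem_pendantEdges {u v : V} (huv : G.Adj u v)
    (h : s(u, v) ∉ pendantEdges G) : 2 ≤ G.degree u ∧ 2 ≤ G.degree v := by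
  simp only [mem_pendantEdges, mem_edgeSet, huv, true_and, Sym2.mem_iff, exists_eq_or_imp,
    exists_eq_left, not_or] at h
  have := (G.degree_pos_iff_exists_adj u).2 ⟨v, huv⟩
  have := (G.degree_pos_iff_exists_adj v).2 ⟨u, huv.symm⟩
  omega

/-- The lower bound for the weight of `e` that depends only on whether `e` is pendant and on the
number of vertices. -/
noncomputable def edgeBound (G : SimpleGraph V) [DecidableRel G.Adj] (e : Sym2 V) : ℝ :=
  if e ∈ pendantEdges G then zagrebWeight 1 (Fintype.card V - 1) else 8

lemma edgeBound_le_edgeWeight (hG : G.Connected) (hV : 3 ≤ Fintype.card V) {e : Sym2 V}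
    (he : e ∈ G.edgeFinset) : edgeBound G e ≤ edgeWeight G e := by
  by_cases h : e ∈ pendantEdges G
  · obtain ⟨u, v, rfl, huv, hu⟩ := exists_eq_mk_of_mem_pendantEdges h
    rw [edgeBound, if_pos h]
    exact zagrebWeight_le_edgeWeight_of_degree_eq_one hG hV huv hu
  · rw [edgeBound, if_neg h]
    induction e with
    | h u v =>
      obtain ⟨hu, hv⟩ := two_le_degree_of_notMem_pendantEdges (mem_edgeFinset.1 he) h
      exact eight_le_edgeWeight hu hv

variable (G) in
lemma sum_edgeBound : ∑ e ∈ G.edgeFinset, edgeBound G e =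
    (pendantEdges G).card * zagrebWeight 1 (Fintype.card V - 1) +
      (G.edgeFinset.card - (pendantEdges G).card) * 8 := by
  have hsub : pendantEdges G ⊆ G.edgeFinset := pendantEdges_subset_edgeFinset
  simp only [edgeBound]
  rw [Finset.sum_ite, Finset.filter_mem_eq_inter, Finset.inter_eq_right.2 hsub,
    Finset.filter_notMem_eq_sdiff, Finset.sum_const, Finset.sum_const, nsmul_eq_mul, nsmul_eq_mul,
    Finset.card_sdiff_of_subset hsub, Nat.cast_sub (Finset.card_le_card hsub)]

variable (G) in
lemma augmentedZagreb_eq_add (k : ℕ) : G.augmentedZagreb =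
    (Fintype.card V - 2 * k - 1) * zagrebWeight 1 (Fintype.card V - 1) + 24 * k +
      (∑ e ∈ G.edgeFinset, (edgeWeight G e - edgeBound G e) +
        (8 - zagrebWeight 1 (Fintype.card V - 1)) *
          (G.edgeFinset.card - ((pendantEdges G).card + 3 * k)) +
        zagrebWeight 1 (Fintype.card V - 1) *
          (G.edgeFinset.card + 1 - (Fintype.card V + k))) := by
  rw [augmentedZagreb_eq_sum_edgeWeight, Finset.sum_sub_distrib, sum_edgeBound]
  ring

lemma le_augmentedZagreb_and_eq_iff (hG : G.IsCactus) (hV : 4 ≤ Fintype.card V) :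
    (Fintype.card V - 2 * G.cycles.ncard - 1) * zagrebWeight 1 (Fintype.card V - 1) +
        24 * G.cycles.ncard ≤ G.augmentedZagreb ∧
      (G.augmentedZagreb =
          (Fintype.card V - 2 * G.cycles.ncard - 1) * zagrebWeight 1 (Fintype.card V - 1) +
            24 * G.cycles.ncard ↔
        (∀ e ∈ G.edgeFinset, edgeWeight G e = edgeBound G e) ∧
          (pendantEdges G).card + 3 * G.cycles.ncard = G.edgeFinset.card ∧
          Fintype.card V + G.cycles.ncard = G.edgeFinset.card + 1) := by
  have hVreal : (4 : ℝ) ≤ Fintype.card V := by exact_mod_cast hV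
  have hpos : 0 < zagrebWeight 1 (Fintype.card V - 1) := zagrebWeight_one_pos (by linarith)
  have hlt_eight : 0 < 8 - zagrebWeight 1 (Fintype.card V - 1) :=
    sub_pos.2 (zagrebWeight_one_lt_eight (by linarith))
  have hpendant : (0 : ℝ) ≤
      G.edgeFinset.card - ((pendantEdges G).card + 3 * G.cycles.ncard) :=
    sub_nonneg.2 (by exact_mod_cast card_pendantEdges_add_three_mul_ncard_cycles_le hG)
  have hcycles : (0 : ℝ) ≤ G.edgeFinset.card + 1 - (Fintype.card V + G.cycles.ncard) :=
    sub_nonneg.2 (by exact_mod_cast card_add_ncard_cycles_le hG)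
  have hterm : ∀ e ∈ G.edgeFinset, 0 ≤ edgeWeight G e - edgeBound G e := fun e he =>
    sub_nonneg.2 (edgeBound_le_edgeWeight hG.connected (by omega) he)
  have hsum := Finset.sum_nonneg hterm
  rw [augmentedZagreb_eq_add G G.cycles.ncard]
  refine ⟨le_add_of_nonneg_right (by positivity), ?_⟩
  rw [add_eq_left, add_eq_zero_iff_of_nonneg (by positivity) (by positivity),
    add_eq_zero_iff_of_nonneg hsum (by positivity), Finset.sum_eq_zero_iff_of_nonneg hterm,
    mul_eq_zero_iff_left hlt_eight.ne', mul_eq_zero_iff_left hpos.ne', and_assoc]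
  simp only [sub_eq_zero]
  norm_cast
  rw [@eq_comm _ G.edgeFinset.card, @eq_comm _ (G.edgeFinset.card + 1)]

lemma exists_isUniversal_of_edgeWeight_eq_edgeBound (hG : G.IsCactus) (hV : 3 ≤ Fintype.card V)
    (hcard : (pendantEdges G).card + 3 * G.cycles.ncard = G.edgeFinset.card)
    (htight : ∀ e ∈ G.edgeFinset, edgeWeight G e = edgeBound G e) : ∃ c, G.IsUniversal c := by
  by_cases hpendant : ∃ e, e ∈ pendantEdges G
  · obtain ⟨e, he⟩ := hpendant
    have hweight := htight e (pendantEdges_subset_edgeFinset he)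
    rw [edgeBound, if_pos he] at hweight
    obtain ⟨u, v, rfl, huv, hu⟩ := exists_eq_mk_of_mem_pendantEdges he
    exact ⟨v, (edgeWeight_eq_zagrebWeight_iff_isUniversal hG.connected hV huv hu).1 hweight⟩
  · rw [not_exists] at hpendant
    refine exists_isUniversal_of_forall_adj_degree_eq_two hG.connected (fun u v huv =>
      exists_adj_adj_of_notMem_pendantEdges hG hcard huv (hpendant _)) fun u v huv => ?_
    have hweight := htight s(u, v) (mem_edgeFinset.2 huv)
    rw [edgeBound, if_neg (hpendant _)] at hweight
    obtain ⟨hu, hv⟩ := two_le_degree_of_notMem_pendantEdges huv (hpendant _)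
    exact (edgeWeight_eq_eight_iff hu hv).1 hweight

lemma edgeWeight_eq_edgeBound_of_isUniversal (hG : G.IsCactus) (hV : 3 ≤ Fintype.card V) {c : V}
    (hc : G.IsUniversal c) {e : Sym2 V} (he : e ∈ G.edgeFinset) :
    edgeWeight G e = edgeBound G e := by
  by_cases h : e ∈ pendantEdges G
  · obtain ⟨u, v, rfl, huv, hu⟩ := exists_eq_mk_of_mem_pendantEdges h
    have huc : u ≠ c := by
      rintro rfl
      have := (G.degree_eq_card_sub_one u).2 hc
      omega
    obtain rfl : v = c := eq_of_adj_of_degree_eq_one hu huv (hc huc.symm).symm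
    rw [edgeBound, if_pos h]
    exact (edgeWeight_eq_zagrebWeight_iff_isUniversal hG.connected hV huv hu).2 hc
  · rw [edgeBound, if_neg h]
    induction e with
    | h u v =>
      have huv : G.Adj u v := mem_edgeFinset.1 he
      obtain ⟨hu, hv⟩ := two_le_degree_of_notMem_pendantEdges huv h
      rw [edgeWeight_eq_eight_iff hu hv]
      by_cases huc : u = c
      · exact .inr <| (degree_le_two_of_isUniversal hG hc (huc ▸ huv.ne')).antisymm hv
      · exact .inl <| (degree_le_two_of_isUniversal hG hc huc).antisymm hu

lemma augmentedZagreb_eq_iff_exists_isUniversal (hG : G.IsCactus) (hV : 4 ≤ Fintype.card V) :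
    G.augmentedZagreb =
        (Fintype.card V - 2 * G.cycles.ncard - 1) * zagrebWeight 1 (Fintype.card V - 1) +
          24 * G.cycles.ncard ↔
      ∃ c, G.IsUniversal c := by
  rw [(le_augmentedZagreb_and_eq_iff hG hV).2]
  refine ⟨fun ⟨htight, hcard, _⟩ =>
    exists_isUniversal_of_edgeWeight_eq_edgeBound hG (by omega) hcard htight, ?_⟩
  rintro ⟨c, hc⟩
  exact ⟨fun e he => edgeWeight_eq_edgeBound_of_isUniversal hG (by omega) hc he,
    card_pendantEdges_add_three_mul_ncard_cycles_of_isUniversal hG hc,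
    (card_edgeFinset_add_one_of_isUniversal hG hc).symm⟩

end Bound

end Cactus

theorem theorem1 {V : Type*} [Fintype V] [DecidableEq V] (G : SimpleGraph V)
    [DecidableRel G.Adj] (n k : ℕ) (hn : 4 ≤ n) (hV : Fintype.card V = n)
    (hG : G.IsCactus) (hk : G.cycles.ncard = k) :
    ((n : ℝ) - 2 * (k : ℝ) - 1) * (((n : ℝ) - 1) / ((n : ℝ) - 2)) ^ 3 + 24 * (k : ℝ)
        ≤ G.augmentedZagreb ∧
      (G.augmentedZagreb =
          ((n : ℝ) - 2 * (k : ℝ) - 1) * (((n : ℝ) - 1) / ((n : ℝ) - 2)) ^ 3 + 24 * (k : ℝ) ↔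
        Nonempty (G ≃g SimpleGraph.starWithEdges n k)) := by
  subst hV hk
  rw [← Cactus.zagrebWeight_one_sub_one]
  exact ⟨(Cactus.le_augmentedZagreb_and_eq_iff hG hn).1,
    (Cactus.augmentedZagreb_eq_iff_exists_isUniversal hG hn).trans
      (Cactus.nonempty_iso_starWithEdges_iff hG).symm⟩
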